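/- For a finite group $G$ let $d(G)$ be the least number of generators of $G$, $Z(G)$ its center and $\gamma_2(G)$ its commutator subgroup. Groups $G$ and $H$ are isoclinic if there are isomorphisms $\varphi : G/Z(G) \to H/Z(H)$ and $\theta : \gamma_2(G) \to \gamma_2(H)$ such that $\theta([x,y]) = [x',y']$ whenever $\varphi(xZ(G)) = x'Z(H)$ and $\varphi(yZ(G)) = y'Z(H)$. Theorem 11.2. Let $p$ be a prime and let $G$ be a finite $p$-group of nilpotency class $2$ such that $|G/Z(G)| = |\gamma_2(G)|^{d}$, where $d = d(G)$ or $d = d(G/Z(G))$. Then there are a positive integer $m$, a positive integer $q$, a cyclic group $X$ of order $q$, finite $p$-groups $G_1, \dots, G_m$ with $d(G_i) = 2$ such that $\gamma_2(G_i) = Z(G_i)$ is cyclic of order $q$ for every $i$, and isomorphisms $\theta_i : X \to Z(G_i)$, such that $G$ is isoclinic to the central product $$Y = G_1 *_X G_2 *_X \cdots *_X G_m = (G_1 \times \cdots \times G_m)\big/\{(\theta_1(x_1), \dots, \theta_m(x_m)) : x_1, \dots, x_m \in X,\ x_1 x_2 \cdots x_m = 1\}$$ of $G_1, \dots, G_m$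 amalgamated at $X$. -/

import Mathlib

universe u v

open scoped commutatorElement

/-- The commutator map `a_G : G/Z(G) × G/Z(G) → γ₂(G)`, `(xZ(G), yZ(G)) ↦ [x, y]`. -/
def commutatorMap (G : Type u) [Group G] :
    G ⧸ Subgroup.center G → G ⧸ Subgroup.center G → commutator G :=
  Quotient.lift₂
    (fun x y => ⟨⁅x, y⁆, Subgroup.commutator_mem_commutator
      (Subgroup.mem_top x) (Subgroup.mem_top y)⟩)
    (by
      intro a b a' b' ha hb
      obtain ⟨z, hz, rfl⟩ : ∃ z ∈ Subgroup.center G, a' = a * z :=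
        ⟨a⁻¹ * a', QuotientGroup.leftRel_apply.mp ha, by group⟩
      obtain ⟨w, hw, rfl⟩ : ∃ w ∈ Subgroup.center G, b' = b * w :=
        ⟨b⁻¹ * b', QuotientGroup.leftRel_apply.mp hb, by group⟩
      rw [Subgroup.mem_center_iff] at hz hw
      apply Subtype.ext
      change a * b * a⁻¹ * b⁻¹ = a * z * (b * w) * (a * z)⁻¹ * (b * w)⁻¹
      have h1 : a * z * (b * w) = a * b * (z * w) := by
        rw [mul_assoc a z, ← mul_assoc z b w, ← hz b]; group
      have h2 : (a * z)⁻¹ * (b * w)⁻¹ = (z * w)⁻¹ * (a⁻¹ * b⁻¹) := by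
        rw [← mul_inv_rev, ← mul_inv_rev, ← mul_inv_rev]
        congr 1
        rw [mul_assoc b w, ← mul_assoc w a z, ← hw a, hw z]; group
      rw [mul_assoc (a * z * (b * w)), h2, h1]
      group)

/-- Two groups are isoclinic (P. Hall) if there are isomorphisms `φ : G/Z(G) ≃ H/Z(H)` and
`θ : γ₂(G) ≃ γ₂(H)` which are compatible with the commutator maps of `G` and `H`. -/
def Isoclinic (G : Type u) (H : Type v) [Group G] [Group H] : Prop :=
  ∃ (φ : G ⧸ Subgroup.center G ≃* H ⧸ Subgroup.center H) (θ : commutator G ≃* commutator H),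
    ∀ a b : G ⧸ Subgroup.center G,
      θ (commutatorMap G a b) = commutatorMap H (φ a) (φ b)

/-- Given maps `θ i` of an abelian group `X` into the centers of groups `H i`, the central
subgroup `{(θ i (x i))_i | ∏ i, x i = 1}` of the direct product of the `H i`. -/
def amalgamationSubgroup {ι : Type v} [Fintype ι] {X : Type u} [CommGroup X]
    {H : ι → Type u} [∀ i, Group (H i)] (θ : ∀ i, X →* Subgroup.center (H i)) :
    Subgroup (∀ i, H i) where
  carrier := {h | ∃ x : ι → X, ∏ i, x i = 1 ∧ ∀ i, h i = θ i (x i)}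
  one_mem' := ⟨1, by simp, by simp⟩
  mul_mem' := by
    rintro a b ⟨x, hx, hax⟩ ⟨y, hy, hby⟩
    exact ⟨x * y, by simp [Finset.prod_mul_distrib, hx, hy], by simp [hax, hby]⟩
  inv_mem' := by
    rintro a ⟨x, hx, hax⟩
    exact ⟨x⁻¹, by simp [hx], by simp [hax]⟩

instance amalgamationSubgroup_normal {ι : Type v} [Fintype ι] {X : Type u} [CommGroup X]
    {H : ι → Type u} [∀ i, Group (H i)] (θ : ∀ i, X →* Subgroup.center (H i)) :
    (amalgamationSubgroup θ).Normal where
  conj_mem := by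
    rintro a ⟨x, hx, hax⟩ g
    refine ⟨x, hx, fun i => ?_⟩
    have h := Subgroup.mem_center_iff.mp (θ i (x i)).2 (g i)
    simp only [Pi.mul_apply, Pi.inv_apply, hax i]
    rw [h, mul_inv_cancel_right]

/-- The central product of the groups `H i` amalgamated at `X`: the quotient of the direct
product of the `H i` in which all the images of `X` under the maps `θ i` are identified. -/
abbrev AmalgamatedCentralProduct {ι : Type v} [Fintype ι] {X : Type u} [CommGroup X]
    {H : ι → Type u} [∀ i, Group (H i)] (θ : ∀ i, X →* Subgroup.center (H i)) :
    Type (max u v) :=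
  (∀ i, H i) ⧸ amalgamationSubgroup θ

/-! In class two the commutator map is an alternating bilinear map from `V = G/Z(G)` to `γ₂(G)` with
trivial radical. Pairing with a minimal generating set `S` of `V` therefore embeds `V` in `γ₂(G)^S`.
Since `|S| ≤ d` for either choice of `d`, the hypothesis `|V| = |γ₂(G)|^d` forces `|S| = d` and
makes the embedding an isomorphism (`commutatorHom_injective`). Moreover `|V|` divides `e^d`, where
`e` is the exponent of `γ₂(G)`; hence `e = |γ₂(G)|` and `γ₂(G)` is cyclic, of order `q = p^(n+1)`.

So `V` is a free module over `ℤ/q` with a nondegenerate alternating form, and such a form has a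
symplectic basis (`exists_symplectic_equiv`). The standard symplectic form of rank `2m` is also the
commutator form of the Heisenberg group with `m` coordinate pairs over `ℤ/q`, which is thus
isoclinic to `G`. That group is the central product of `m` Heisenberg groups with one coordinate
pair each, and these are the factors sought. -/

/-- Isoclinism can be checked on models of the central quotient and the commutator subgroup. -/
theorem Isoclinic.of_models {G : Type u} {H : Type v} [Group G] [Group H] {V C : Type*}
    [Group V] [Group C] (β : V → V → C)
    (f : G →* V) (hf : Function.Surjective f) (hfk : f.ker = Subgroup.center G)
    (g : commutator G ≃* C) (hg : ∀ x y : G, g (commutatorMap G x y) = β (f x) (f y))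
    (f' : H →* V) (hf' : Function.Surjective f') (hfk' : f'.ker = Subgroup.center H)
    (g' : commutator H ≃* C) (hg' : ∀ x y : H, g' (commutatorMap H x y) = β (f' x) (f' y)) :
    Isoclinic G H := by
  let a : G ⧸ Subgroup.center G ≃* V := (QuotientGroup.quotientMulEquivOfEq hfk.symm).trans
    (QuotientGroup.quotientKerEquivOfSurjective f hf)
  let b : H ⧸ Subgroup.center H ≃* V := (QuotientGroup.quotientMulEquivOfEq hfk'.symm).trans
    (QuotientGroup.quotientKerEquivOfSurjective f' hf')
  have ha : ∀ x : G, a x = f x := fun _ => rfl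
  have hb : ∀ x : H, b x = f' x := fun _ => rfl
  refine ⟨a.trans b.symm, g.trans g'.symm, fun x y => ?_⟩
  obtain ⟨x, rfl⟩ := QuotientGroup.mk_surjective x
  obtain ⟨y, rfl⟩ := QuotientGroup.mk_surjective y
  obtain ⟨z, hz⟩ := hf' (f x)
  obtain ⟨w, hw⟩ := hf' (f y)
  have h1 : (a.trans b.symm) x = z := by
    simp [MulEquiv.symm_apply_eq, ha, hb, hz]
  have h2 : (a.trans b.symm) y = w := by
    simp [MulEquiv.symm_apply_eq, ha, hb, hw]
  rw [h1, h2, MulEquiv.trans_apply, MulEquiv.symm_apply_eq, hg, hg', hz, hw]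

/-- An amalgamated central product is the image of any surjective homomorphism with the right
kernel. -/
noncomputable def AmalgamatedCentralProduct.equivOfKerEq {ι : Type v} [Fintype ι] {X : Type u}
    [CommGroup X] {H : ι → Type u} [∀ i, Group (H i)] (θ : ∀ i, X →* Subgroup.center (H i))
    {K : Type*} [Group K] (f : (∀ i, H i) →* K) (hf : Function.Surjective f)
    (hk : f.ker = amalgamationSubgroup θ) : AmalgamatedCentralProduct θ ≃* K :=
  (QuotientGroup.quotientMulEquivOfEq hk.symm).trans
    (QuotientGroup.quotientKerEquivOfSurjective f hf)

/-! ### Heisenberg groups and their central product decomposition -/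

/-- The Heisenberg group of a commutative ring `R` with coordinates indexed by `ι`. -/
@[ext] structure Heis (ι : Type v) (R : Type u) where
  a : ι → R
  b : ι → R
  c : R

namespace Heis
variable {ι : Type v} {R : Type u} [CommRing R]

/-- The cocycle is the bilinear `a ⬝ᵥ b'`, not half a symplectic form, so `p = 2` needs no separate
treatment; commutators antisymmetrize it. -/
instance [Fintype ι] : Mul (Heis ι R) := ⟨fun x y => ⟨x.a + y.a, x.b + y.b, x.c + y.c + x.a ⬝ᵥ y.b⟩⟩
instance : One (Heis ι R) := ⟨⟨0, 0, 0⟩⟩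
instance [Fintype ι] : Inv (Heis ι R) := ⟨fun x => ⟨-x.a, -x.b, -x.c + x.a ⬝ᵥ x.b⟩⟩

@[simp] lemma one_a : (1 : Heis ι R).a = 0 := rfl
@[simp] lemma one_b : (1 : Heis ι R).b = 0 := rfl
@[simp] lemma one_c : (1 : Heis ι R).c = 0 := rfl

variable [Fintype ι]

@[simp] lemma mul_a (x y : Heis ι R) : (x * y).a = x.a + y.a := rfl
@[simp] lemma mul_b (x y : Heis ι R) : (x * y).b = x.b + y.b := rfl
@[simp] lemma mul_c (x y : Heis ι R) : (x * y).c = x.c + y.c + x.a ⬝ᵥ y.b := rfl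
@[simp] lemma inv_a (x : Heis ι R) : (x⁻¹).a = -x.a := rfl
@[simp] lemma inv_b (x : Heis ι R) : (x⁻¹).b = -x.b := rfl
@[simp] lemma inv_c (x : Heis ι R) : (x⁻¹).c = -x.c + x.a ⬝ᵥ x.b := rfl

instance : Group (Heis ι R) := Group.ofLeftAxioms
  (fun x y z => by
    ext <;> simp [add_assoc, dotProduct_add, add_dotProduct]
    ring)
  (fun x => by ext <;> simp)
  (fun x => by ext <;> simp)

lemma commutator_eq (x y : Heis ι R) : ⁅x, y⁆ = ⟨0, 0, x.a ⬝ᵥ y.b - y.a ⬝ᵥ x.b⟩ := by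
  rw [commutatorElement_def]
  ext <;> simp [add_dotProduct]
  ring

/-- The projection of the Heisenberg group to its abelianization. -/
@[simps] def toProd : Heis ι R →* Multiplicative ((ι → R) × (ι → R)) where
  toFun x := Multiplicative.ofAdd (x.a, x.b)
  map_one' := rfl
  map_mul' _ _ := rfl

lemma toProd_surjective : Function.Surjective (toProd (ι := ι) (R := R)) := fun x =>
  ⟨⟨x.toAdd.1, x.toAdd.2, 0⟩, rfl⟩

lemma mem_center_iff {x : Heis ι R} : x ∈ Subgroup.center (Heis ι R) ↔ x.a = 0 ∧ x.b = 0 := by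
  classical
  rw [Subgroup.mem_center_iff]
  constructor
  · intro h
    have h' : ∀ y : Heis ι R, x.a ⬝ᵥ y.b - y.a ⬝ᵥ x.b = 0 := fun y => by
      have := commutatorElement_eq_one_iff_mul_comm.mpr (h y).symm
      rw [commutator_eq] at this
      exact congrArg Heis.c this
    constructor <;> ext i
    · simpa using h' ⟨0, Pi.single i 1, 0⟩
    · simpa using h' ⟨Pi.single i 1, 0, 0⟩
  · rintro ⟨ha, hb⟩ y
    ext <;> simp [ha, hb, add_comm]

lemma ker_toProd : (toProd (ι := ι) (R := R)).ker = Subgroup.center (Heis ι R) := by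
  ext x
  rw [mem_center_iff, MonoidHom.mem_ker]
  exact ⟨fun h => by simpa [Prod.ext_iff] using congrArg Multiplicative.toAdd h,
    fun h => by simp [h.1, h.2]⟩

/-- The center of the Heisenberg group is the additive group of the ring. -/
def centerEquiv : Multiplicative R ≃* Subgroup.center (Heis ι R) where
  toFun r := ⟨⟨0, 0, r.toAdd⟩, mem_center_iff.mpr ⟨rfl, rfl⟩⟩
  invFun x := Multiplicative.ofAdd x.1.c
  left_inv _ := rfl
  right_inv := by
    rintro ⟨x, hx⟩
    obtain ⟨ha, hb⟩ := mem_center_iff.mp hx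
    ext <;> simp [ha, hb]
  map_mul' r s := by
    ext <;> simp

@[simp] lemma coe_centerEquiv (r : Multiplicative R) :
    (centerEquiv (ι := ι) r : Heis ι R) = ⟨0, 0, r.toAdd⟩ := rfl

lemma commutator_eq_center [Nonempty ι] :
    commutator (Heis ι R) = Subgroup.center (Heis ι R) := by
  classical
  apply le_antisymm
  · rw [commutator_def, Subgroup.commutator_le]
    intro x _ y _
    rw [commutator_eq, mem_center_iff]
    exact ⟨rfl, rfl⟩
  · intro x hx
    obtain ⟨ha, hb⟩ := mem_center_iff.mp hx
    obtain ⟨i⟩ := ‹Nonempty ι›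
    have : x = ⁅(⟨Pi.single i x.c, 0, 0⟩ : Heis ι R), ⟨0, Pi.single i 1, 0⟩⁆ := by
      rw [commutator_eq]
      ext <;> simp [ha, hb]
    rw [this]
    exact Subgroup.commutator_mem_commutator (Subgroup.mem_top _) (Subgroup.mem_top _)

/-- The symplectic form on the abelianization of the Heisenberg group. -/
def form (x y : Multiplicative ((ι → R) × (ι → R))) : Multiplicative R :=
  Multiplicative.ofAdd (x.toAdd.1 ⬝ᵥ y.toAdd.2 - y.toAdd.1 ⬝ᵥ x.toAdd.2)

/-- The commutator subgroup of the Heisenberg group is the additive group of the ring. -/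
def commutatorEquiv [Nonempty ι] : commutator (Heis ι R) ≃* Multiplicative R :=
  (MulEquiv.subgroupCongr commutator_eq_center).trans centerEquiv.symm

lemma commutatorEquiv_commutatorMap [Nonempty ι] (x y : Heis ι R) :
    commutatorEquiv (commutatorMap (Heis ι R) x y) = form (toProd x) (toProd y) := by
  change Multiplicative.ofAdd (⁅x, y⁆).c = _
  rw [commutator_eq]
  rfl

/-- The coordinates of a Heisenberg group. -/
def equivProd : Heis ι R ≃ (ι → R) × (ι → R) × R where
  toFun x := (x.a, x.b, x.c)
  invFun x := ⟨x.1, x.2.1, x.2.2⟩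

instance [Finite R] : Finite (Heis ι R) := Finite.of_equiv _ equivProd.symm

lemma isPGroup {p n : ℕ} (h : Nat.card R = p ^ n) : IsPGroup p (Heis ι R) := by
  apply IsPGroup.of_card (n := n * Fintype.card ι + (n * Fintype.card ι + n))
  rw [Nat.card_congr equivProd, Nat.card_prod, Nat.card_prod, Nat.card_fun, h, pow_add, pow_add,
    pow_mul, Nat.card_eq_fintype_card]

/-- Every scalar is a multiple of `1`, so the two unit vectors and their commutator reach every
element; one generator is too few because the unit vectors do not commute. -/
lemma rank_eq_two [Finite R] [Nontrivial R] (h : ∀ r : R, ∃ k : ℕ, (k : R) = r) :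
    Group.rank (Heis Unit R) = 2 := by
  classical
  -- When one coordinate vanishes, so does the cocycle term, and powers are computed coordinatewise.
  have hpow : ∀ (x : Heis Unit R) (k : ℕ), (x.a = 0 ∨ x.b = 0) →
      x ^ k = ⟨k • x.a, k • x.b, k • x.c⟩ := by
    intro x k hx
    induction k with
    | zero => ext <;> simp
    | succ k ih =>
      rw [pow_succ, ih]
      rcases hx with hx | hx <;> ext <;> simp [hx, add_mul]
  let x : Heis Unit R := ⟨1, 0, 0⟩
  let y : Heis Unit R := ⟨0, 1, 0⟩
  have hxy : Subgroup.closure ({x, y} : Set (Heis Unit R)) = ⊤ := by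
    rw [eq_top_iff]
    intro z _
    have hx : x ∈ Subgroup.closure ({x, y} : Set (Heis Unit R)) :=
      Subgroup.subset_closure (by simp)
    have hy : y ∈ Subgroup.closure ({x, y} : Set (Heis Unit R)) :=
      Subgroup.subset_closure (by simp)
    obtain ⟨k, hk⟩ := h (z.a ())
    obtain ⟨l, hl⟩ := h (z.b ())
    obtain ⟨m, hm⟩ := h z.c
    -- With `y` to the left of `x` the cocycle contributes nothing, so the exponents are exactly the
    -- coordinates of `z`.
    have : z = y ^ l * x ^ k * ⁅x, y⁆ ^ m := by
      rw [commutator_eq, hpow _ _ (Or.inl rfl), hpow _ _ (Or.inr rfl), hpow _ _ (Or.inl rfl)]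
      ext <;> simp [x, y, hk, hl, hm]
    rw [this, commutatorElement_def]
    exact mul_mem (mul_mem (pow_mem hy _) (pow_mem hx _))
      (pow_mem (mul_mem (mul_mem (mul_mem hx hy) (inv_mem hx)) (inv_mem hy)) _)
  apply le_antisymm
  · refine (Group.rank_le (S := {x, y}) (by simpa using hxy)).trans Finset.card_le_two
  · by_contra! hlt
    obtain ⟨S, hS, hS'⟩ := Group.rank_spec (Heis Unit R)
    obtain ⟨g, hg⟩ := Finset.card_le_one_iff_subset_singleton.mp (by omega : S.card ≤ 1)
    have htop : ∀ z, z ∈ Subgroup.zpowers g := fun z => by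
      have : (⊤ : Subgroup (Heis Unit R)) ≤ Subgroup.zpowers g := by
        rw [← hS', Subgroup.zpowers_eq_closure]
        exact Subgroup.closure_mono (by exact_mod_cast hg)
      exact this trivial
    obtain ⟨k, hk⟩ := htop x
    obtain ⟨l, hl⟩ := htop y
    have hc : ⁅x, y⁆ = 1 := by
      rw [commutatorElement_eq_one_iff_mul_comm, ← hk, ← hl]
      exact ((Commute.refl g).zpow_zpow k l).eq
    rw [commutator_eq] at hc
    have := congrArg Heis.c hc
    simp [x, y] at this

/-- Adding up the central coordinates of Heisenberg groups of rank two. -/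
@[simps] def sum : (ι → Heis Unit R) →* Heis ι R where
  toFun h := ⟨fun i => (h i).a (), fun i => (h i).b (), ∑ i, (h i).c⟩
  map_one' := by ext <;> simp
  map_mul' x y := by ext <;> simp [Finset.sum_add_distrib, dotProduct]

lemma sum_surjective [Nonempty ι] : Function.Surjective (sum (ι := ι) (R := R)) := by
  classical
  intro x
  obtain ⟨i⟩ := ‹Nonempty ι›
  -- The whole central coordinate is placed in a single factor.
  refine ⟨fun j => ⟨fun _ => x.a j, fun _ => x.b j, (Pi.single i x.c : ι → R) j⟩, ?_⟩
  exact Heis.ext rfl rfl (by simp)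

lemma ker_sum : (sum (ι := ι) (R := R)).ker =
    amalgamationSubgroup (fun _ : ι => (centerEquiv (ι := Unit) (R := R)).toMonoidHom) := by
  ext h
  rw [MonoidHom.mem_ker]
  constructor
  · intro hh
    refine ⟨fun i => Multiplicative.ofAdd (h i).c, congrArg Heis.c hh, fun i => ?_⟩
    ext j
    · exact congrFun (congrArg Heis.a hh) i
    · exact congrFun (congrArg Heis.b hh) i
    · rfl
  · rintro ⟨x, hx, hh⟩
    have hx' : ∑ i, (x i).toAdd = 0 := hx
    ext <;> simp [hh, hx']

/-- The Heisenberg group is a central product of Heisenberg groups of rank two. -/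
noncomputable def amalgamEquiv [Nonempty ι] : AmalgamatedCentralProduct
    (fun _ : ι => (centerEquiv (ι := Unit) (R := R)).toMonoidHom) ≃* Heis ι R :=
  AmalgamatedCentralProduct.equivOfKerEq _ sum sum_surjective ker_sum

end Heis

/-! ### Symplectic bases of alternating forms -/

namespace LinearMap.BilinForm
variable {R : Type*} {V : Type*} [CommRing R] [AddCommGroup V] [Module R V]

/-- The families `x`, `y` satisfy the relations of a symplectic basis for the form `B`. -/
structure IsHyperbolic (B : LinearMap.BilinForm R V) {m : ℕ} (x y : Fin m → V) : Prop where
  left : ∀ i j, B (x i) (x j) = 0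
  right : ∀ i j, B (y i) (y j) = 0
  mixed : ∀ i j, B (x i) (y j) = if i = j then 1 else 0

/-- The component orthogonal to a hyperbolic family. -/
def orthoPart (B : LinearMap.BilinForm R V) {m : ℕ} (x y : Fin m → V) : V →ₗ[R] V where
  toFun v := v - ∑ i, B v (y i) • x i - ∑ i, B (x i) v • y i
  map_add' v w := by
    simp only [map_add, LinearMap.add_apply, add_smul, Finset.sum_add_distrib]
    abel
  map_smul' r v := by
    simp [mul_smul, Finset.smul_sum, smul_sub]

variable {B : LinearMap.BilinForm R V} {m : ℕ} {x y : Fin m → V}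

lemma IsHyperbolic.left_orthoPart (h : IsHyperbolic B x y) (i : Fin m) (v : V) :
    B (x i) (orthoPart B x y v) = 0 := by
  simp [orthoPart, h.left, h.mixed]

lemma IsHyperbolic.right_orthoPart (h : IsHyperbolic B x y) (i : Fin m) (v : V) :
    B (orthoPart B x y v) (y i) = 0 := by
  simp [orthoPart, h.right, h.mixed]

lemma IsHyperbolic.injective [Nontrivial R] (h : IsHyperbolic B x y) : Function.Injective x := by
  intro i j hij
  by_contra hne
  have h1 := h.mixed i j
  rw [hij, h.mixed] at h1
  simp [hne] at h1

/-- This extension step is what contradicts maximality of a hyperbolic family. -/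
lemma IsHyperbolic.snoc (hB : B.IsAlt) (h : IsHyperbolic B x y) {v w : V}
    (hxv : ∀ i, B (x i) v = 0) (hvy : ∀ i, B v (y i) = 0)
    (hxw : ∀ i, B (x i) w = 0) (hwy : ∀ i, B w (y i) = 0) (hvw : B v w = 1) :
    IsHyperbolic B (Fin.snoc x v : Fin (m + 1) → V) (Fin.snoc y w : Fin (m + 1) → V) := by
  have hyw : ∀ i, B (y i) w = 0 := fun i => by rw [← hB.neg_eq, hwy, neg_zero]
  have hvx : ∀ i, B v (x i) = 0 := fun i => by rw [← hB.neg_eq, hxv, neg_zero]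
  constructor
  · intro i j
    induction i using Fin.lastCases <;> induction j using Fin.lastCases <;>
      simp [h.left, hvx, hxv, hB v]
  · intro i j
    induction i using Fin.lastCases <;> induction j using Fin.lastCases <;>
      simp [h.right, hyw, hwy, hB w]
  · intro i j
    induction i using Fin.lastCases <;> induction j using Fin.lastCases <;>
      simp [h.mixed, hvy, hxw, hvw, Fin.ext_iff, (Fin.castSucc_ne_last _).symm]
    all_goals omega

/-- A nondegenerate alternating form on a finite homocyclic module over a chain ring has a
symplectic basis. -/
theorem exists_symplectic_equiv [Nontrivial R] [Finite V] (hB : B.IsAlt)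
    (hnd : ∀ v, (∀ w, B v w = 0) → v = 0) (π : R) (n : ℕ) (hπ : π ^ (n + 1) = 0)
    (hunit : ∀ a : R, π ^ n * a ≠ 0 → IsUnit a)
    (hV : ∀ v : V, π ^ n • v = 0 → ∃ w, v = π • w) :
    ∃ (m : ℕ) (f : V ≃ₗ[R] (Fin m → R) × (Fin m → R)), ∀ v w,
      B v w = (f v).1 ⬝ᵥ (f w).2 - (f w).1 ⬝ᵥ (f v).2 := by
  classical
  -- Finiteness of `V` bounds hyperbolic families, so a largest one exists.
  have hbdd : ∀ m : ℕ, (∃ x y : Fin m → V, IsHyperbolic B x y) → m ≤ Nat.card V := by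
    rintro m ⟨x, y, h⟩
    simpa using Nat.card_le_card_of_injective x h.injective
  have h0 : ∃ x y : Fin 0 → V, IsHyperbolic B x y :=
    ⟨Fin.elim0, Fin.elim0, ⟨fun i => i.elim0, fun i => i.elim0, fun i => i.elim0⟩⟩
  obtain ⟨x, y, h⟩ := Nat.findGreatest_spec (P := fun m => ∃ x y : Fin m → V, IsHyperbolic B x y)
    (Nat.zero_le (Nat.card V)) h0
  have hmax := fun k hk => hbdd k hk |> fun hle => Nat.le_findGreatest
    (P := fun m => ∃ x y : Fin m → V, IsHyperbolic B x y) hle hk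
  generalize Nat.findGreatest (fun m => ∃ x y : Fin m → V, IsHyperbolic B x y) (Nat.card V) = m
    at x y h hmax
  let P := orthoPart B x y
  have hPfix : ∀ v, (∀ i, B v (y i) = 0) → (∀ i, B (x i) v = 0) → P v = v := by
    intro v h1 h2
    simp [P, orthoPart, h1, h2]
  have hPP : ∀ v, P (P v) = P v := fun v =>
    hPfix _ (fun i => h.right_orthoPart i v) (fun i => h.left_orthoPart i v)
  have horth : ∀ v w, B (P v) w = B (P v) (P w) := by
    intro v w
    have h1 : ∀ i, B (P v) (x i) = 0 := fun i => by
      rw [← hB.neg_eq, h.left_orthoPart, neg_zero]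
    have h2 : ∀ i, B (P v) (y i) = 0 := fun i => h.right_orthoPart i v
    conv_rhs => rw [show P w = w - ∑ i, B w (y i) • x i - ∑ i, B (x i) w • y i from rfl]
    simp [h1, h2]
  -- Otherwise nondegeneracy gives `w` with `π ^ n * B (P v) w ≠ 0`, so `B (P v) w` is a unit;
  -- rescaling `P w` then yields a new hyperbolic pair orthogonal to the maximal family.
  have hkill : ∀ v, π ^ n • P v = 0 := by
    intro v
    by_contra hne
    obtain ⟨w, hw⟩ : ∃ w, B (π ^ n • P v) w ≠ 0 := by
      by_contra! hall
      exact hne (hnd _ hall)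
    rw [map_smul, LinearMap.smul_apply, smul_eq_mul] at hw
    obtain ⟨u, hu⟩ := hunit _ hw
    have hvw : B (P v) ((↑u⁻¹ : R) • P w) = 1 := by
      rw [map_smul, ← horth, ← hu, smul_eq_mul, Units.inv_mul]
    have := hmax _ ⟨_, _, h.snoc hB (fun i => h.left_orthoPart i v)
      (fun i => h.right_orthoPart i v)
      (fun i => by rw [map_smul, h.left_orthoPart, smul_zero])
      (fun i => by rw [map_smul, LinearMap.smul_apply, h.right_orthoPart, smul_zero]) hvw⟩
    omega
  -- An element killed by `π ^ n` is divisible by `π`, and applying the idempotent `P` keeps the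
  -- quotient in the orthogonal complement. So `P v` is divisible by every power of `π`, in
  -- particular by `π ^ (n + 1) = 0`.
  have hdiv : ∀ k v, ∃ w, P v = π ^ k • P w := by
    intro k v
    induction k with
    | zero => exact ⟨v, by simp⟩
    | succ k ih =>
      obtain ⟨w, hw⟩ := ih
      obtain ⟨u, hu⟩ := hV _ (hkill w)
      refine ⟨u, ?_⟩
      rw [hw, ← hPP w, hu, map_smul, pow_succ, mul_smul]
  have hP : ∀ v, P v = 0 := by
    intro v
    obtain ⟨w, hw⟩ := hdiv (n + 1) v
    rw [hw, hπ, zero_smul]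
  have hexp : ∀ v, v = ∑ i, B v (y i) • x i + ∑ i, B (x i) v • y i := by
    intro v
    have := hP v
    rw [show P v = v - ∑ i, B v (y i) • x i - ∑ i, B (x i) v • y i from rfl, sub_sub,
      sub_eq_zero] at this
    exact this
  let f : V →ₗ[R] (Fin m → R) × (Fin m → R) :=
    (LinearMap.pi fun i => B.flip (y i)).prod (LinearMap.pi fun i => B (x i))
  have hf1 : ∀ v i, (f v).1 i = B v (y i) := fun _ _ => rfl
  have hf2 : ∀ v i, (f v).2 i = B (x i) v := fun _ _ => rfl
  have hinj : Function.Injective f := by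
    intro v w hvw
    rw [hexp v, hexp w]
    simp only [← hf1, ← hf2, hvw]
  have hsurj : Function.Surjective f := by
    intro z
    refine ⟨∑ i, z.1 i • x i + ∑ i, z.2 i • y i, ?_⟩
    ext j
    · rw [hf1]
      simp [h.mixed, h.right]
    · rw [hf2]
      simp [h.mixed, h.left]
  refine ⟨m, LinearEquiv.ofBijective f ⟨hinj, hsurj⟩, fun v w => ?_⟩
  change B v w = (f v).1 ⬝ᵥ (f w).2 - (f w).1 ⬝ᵥ (f v).2
  simp only [dotProduct, hf1, hf2]
  conv_lhs => rw [hexp v]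
  have h3 : ∀ i, B (y i) w = - B w (y i) := fun i => by rw [hB.neg_eq]
  simp only [map_add, map_sum, LinearMap.add_apply, LinearMap.sum_apply, map_smul,
    LinearMap.smul_apply, smul_eq_mul, h3]
  rw [sub_eq_add_neg, ← Finset.sum_neg_distrib]
  congr 1
  exact Finset.sum_congr rfl fun i _ => by ring

end LinearMap.BilinForm

/-! ### The commutator form of a group of class two -/

section CommutatorForm
variable {G : Type u} [Group G]

lemma commutator_le_center_of_nilpotencyClass_eq_two (h : Group.nilpotencyClass G = 2) :
    commutator G ≤ Subgroup.center G := by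
  by_cases hn : Group.IsNilpotent G
  · have h2 := Subgroup.upperCentralSeries_nilpotencyClass (G := G)
    rw [h] at h2
    rw [commutator_def, Subgroup.commutator_le]
    intro x _ y _
    rw [← Subgroup.upperCentralSeries_one]
    have : x ∈ Subgroup.upperCentralSeries G 2 := by rw [h2]; exact Subgroup.mem_top x
    exact Subgroup.mem_upperCentralSeries_succ_iff.mp this y
  -- The class of a non-nilpotent group is `0` by convention, so class `2` excludes this case.
  · rw [Group.nilpotencyClass_of_not_nilpotent hn] at h
    omega

lemma commutator_ne_bot_of_nilpotencyClass_eq_two (h : Group.nilpotencyClass G = 2) :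
    commutator G ≠ ⊥ := by
  intro hbot
  have hcomm : ∀ x y : G, x * y = y * x := fun x y => by
    rw [← commutatorElement_eq_one_iff_mul_comm, ← Subgroup.mem_bot, ← hbot]
    exact Subgroup.commutator_mem_commutator (Subgroup.mem_top x) (Subgroup.mem_top y)
  let _ : CommGroup G := { ‹Group G› with mul_comm := hcomm }
  have := CommGroup.nilpotencyClass_le_one (G := G)
  omega

/-- In general `⁅x * y, z⁆` is the `x`-conjugate of `⁅y, z⁆` times `⁅x, z⁆`; centrality removes the
conjugation. -/
lemma commutatorElement_mul_left (h : commutator G ≤ Subgroup.center G) (x y z : G) :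
    ⁅x * y, z⁆ = ⁅x, z⁆ * ⁅y, z⁆ := by
  have h1 := Subgroup.mem_center_iff.mp (h (Subgroup.commutator_mem_commutator
    (Subgroup.mem_top y) (Subgroup.mem_top z))) x
  have h2 := Subgroup.mem_center_iff.mp (h (Subgroup.commutator_mem_commutator
    (Subgroup.mem_top y) (Subgroup.mem_top z))) (⁅x, z⁆)
  have h3 : ⁅x * y, z⁆ = x * ⁅y, z⁆ * x⁻¹ * ⁅x, z⁆ := by
    simp only [commutatorElement_def]
    group
  rw [h3, h1, h2]
  group

lemma commutatorMap_mk (x y : G) : (commutatorMap G x y : G) = ⁅x, y⁆ := rfl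

lemma commutatorMap_mul_left (h : commutator G ≤ Subgroup.center G)
    (a b c : G ⧸ Subgroup.center G) :
    commutatorMap G (a * b) c = commutatorMap G a c * commutatorMap G b c := by
  obtain ⟨x, rfl⟩ := QuotientGroup.mk_surjective a
  obtain ⟨y, rfl⟩ := QuotientGroup.mk_surjective b
  obtain ⟨z, rfl⟩ := QuotientGroup.mk_surjective c
  exact Subtype.ext (commutatorElement_mul_left h x y z)

lemma commutatorMap_inv (a b : G ⧸ Subgroup.center G) :
    (commutatorMap G a b)⁻¹ = commutatorMap G b a := by
  obtain ⟨x, rfl⟩ := QuotientGroup.mk_surjective a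
  obtain ⟨y, rfl⟩ := QuotientGroup.mk_surjective b
  exact Subtype.ext (commutatorElement_inv x y)

lemma commutatorMap_mul_right (h : commutator G ≤ Subgroup.center G)
    (a b c : G ⧸ Subgroup.center G) :
    commutatorMap G a (b * c) = commutatorMap G a b * commutatorMap G a c := by
  rw [← commutatorMap_inv, commutatorMap_mul_left h, mul_inv_rev, commutatorMap_inv,
    commutatorMap_inv]
  exact Subtype.ext (Subgroup.mem_center_iff.mp (h (commutatorMap G a b).2) _)

lemma commutatorMap_self (a : G ⧸ Subgroup.center G) : commutatorMap G a a = 1 := by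
  obtain ⟨x, rfl⟩ := QuotientGroup.mk_surjective a
  exact Subtype.ext (commutatorElement_self x)

lemma commutator_eq_bot_of_subsingleton (h : Subsingleton (G ⧸ Subgroup.center G)) :
    commutator G = ⊥ := by
  rw [commutator_def, eq_bot_iff, Subgroup.commutator_le]
  intro x _ y _
  rw [Subgroup.mem_bot, ← commutatorMap_mk, Subsingleton.elim (x : G ⧸ Subgroup.center G) y,
    commutatorMap_self]
  rfl

lemma eq_one_of_commutatorMap_eq_one {a : G ⧸ Subgroup.center G}
    (h : ∀ b, commutatorMap G a b = 1) : a = 1 := by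
  obtain ⟨x, rfl⟩ := QuotientGroup.mk_surjective a
  rw [QuotientGroup.eq_one_iff, Subgroup.mem_center_iff]
  intro y
  exact (commutatorElement_eq_one_iff_mul_comm.mp (congrArg Subtype.val (h y))).symm

lemma quotient_center_mul_comm (h : commutator G ≤ Subgroup.center G)
    (a b : G ⧸ Subgroup.center G) : a * b = b * a := by
  obtain ⟨x, rfl⟩ := QuotientGroup.mk_surjective a
  obtain ⟨y, rfl⟩ := QuotientGroup.mk_surjective b
  rw [← commutatorElement_eq_one_iff_mul_comm]
  exact (QuotientGroup.eq_one_iff _).mpr (h (Subgroup.commutator_mem_commutator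
    (Subgroup.mem_top x) (Subgroup.mem_top y)))

/-- Commuting with the elements of a set `S` in a group of class two, as a homomorphism. -/
def commutatorHom (h : commutator G ≤ Subgroup.center G) (S : Finset (G ⧸ Subgroup.center G)) :
    G ⧸ Subgroup.center G →* (S → commutator G) where
  toFun a s := commutatorMap G a s
  map_one' := funext fun s => by
    have := commutatorMap_mul_left h 1 1 (s : G ⧸ Subgroup.center G)
    simpa using this
  map_mul' a b := funext fun s => commutatorMap_mul_left h a b s

/-- The elements pairing trivially with `a` form a subgroup; if it contains generators it is
everything, and nondegeneracy gives `a = 1`. -/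
lemma commutatorHom_injective (h : commutator G ≤ Subgroup.center G)
    {S : Finset (G ⧸ Subgroup.center G)} (hS : Subgroup.closure (S : Set (G ⧸ Subgroup.center G)) = ⊤) :
    Function.Injective (commutatorHom h S) := by
  rw [injective_iff_map_eq_one]
  intro a ha
  apply eq_one_of_commutatorMap_eq_one
  let f : G ⧸ Subgroup.center G →* commutator G :=
    MonoidHom.mk' (commutatorMap G a) (commutatorMap_mul_right h a)
  have hle : Subgroup.closure (S : Set (G ⧸ Subgroup.center G)) ≤ f.ker := by
    rw [Subgroup.closure_le]
    exact fun s hs => congrFun ha ⟨s, hs⟩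
  intro b
  have hb : b ∈ f.ker := hle (hS ▸ Subgroup.mem_top b)
  exact hb

/-- If the central quotient of a group of class two is as large as the number of its generators
permits, then it is a power of the commutator subgroup, and the latter is cyclic. -/
theorem isCyclic_commutator_and_nonempty_mulEquiv [Finite G]
    (h : commutator G ≤ Subgroup.center G) (hbot : commutator G ≠ ⊥) {d : ℕ}
    (hd : Group.rank (G ⧸ Subgroup.center G) ≤ d)
    (hcard : Nat.card (G ⧸ Subgroup.center G) = Nat.card (commutator G) ^ d) :
    IsCyclic (commutator G) ∧
      ∃ r : ℕ, Nonempty (G ⧸ Subgroup.center G ≃* (Fin r → commutator G)) := by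
  obtain ⟨S, hSr, hS⟩ := Group.rank_spec (G ⧸ Subgroup.center G)
  have hinj := commutatorHom_injective h hS
  have hC : 1 < Nat.card (commutator G) := (Subgroup.one_lt_card_iff_ne_bot _).mpr hbot
  have hle := Nat.card_le_card_of_injective _ hinj
  have hcS : Nat.card (S → commutator G) = Nat.card (commutator G) ^ S.card := by
    simp [Nat.card_fun]
  have hdr : d = S.card := by
    apply le_antisymm _ (hSr ▸ hd)
    rw [hcard, hcS] at hle
    exact (Nat.pow_le_pow_iff_right hC).mp hle
  have hbij : Function.Bijective (commutatorHom h S) :=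
    (Nat.bijective_iff_injective_and_card _).mpr ⟨hinj, by rw [hcard, hcS, hdr]⟩
  -- Needed below to cancel `d`-th powers in a divisibility.
  have hd0 : d ≠ 0 := by
    rintro rfl
    rw [pow_zero, Nat.card_eq_one_iff_unique] at hcard
    exact hbot (commutator_eq_bot_of_subsingleton hcard.1)
  refine ⟨?_, S.card, ⟨(MulEquiv.ofBijective _ hbij).trans
    (MulEquiv.arrowCongr S.equivFin (MulEquiv.refl _))⟩⟩
  let _ : CommGroup (G ⧸ Subgroup.center G) :=
    { (inferInstance : Group (G ⧸ Subgroup.center G)) with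
      mul_comm := quotient_center_mul_comm h }
  let _ : CommGroup (commutator G) :=
    { (inferInstance : Group (commutator G)) with
      mul_comm := fun a b => Subtype.ext (Subgroup.mem_center_iff.mp (h b.2) a) }
  apply IsCyclic.of_exponent_eq_card
  -- The embedding into a power of `γ₂(G)` bounds the exponent of the quotient, and an abelian group
  -- of rank `d` has order dividing the `d`-th power of any such bound.
  have hexp : ∀ v : G ⧸ Subgroup.center G, v ^ Monoid.exponent (commutator G) = 1 := fun v => by
    apply hinj
    rw [map_pow, map_one]
    exact funext fun s => Monoid.pow_exponent_eq_one _
  have hdvd := card_dvd_exponent_pow_rank' _ hexp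
  rw [hcard, show Group.rank (G ⧸ Subgroup.center G) = d from hSr.symm.trans hdr.symm,
    Nat.pow_dvd_pow_iff hd0] at hdvd
  exact Nat.dvd_antisymm Group.exponent_dvd_nat_card hdvd

end CommutatorForm

/-! ### From the commutator form to a Heisenberg group -/

/-- This and the next lemma supply the hypotheses of `exists_symplectic_equiv` with `π = p`. -/
lemma ZMod.isUnit_of_pow_mul_ne_zero {p n : ℕ} (hp : p.Prime) {a : ZMod (p ^ (n + 1))}
    (h : (p : ZMod (p ^ (n + 1))) ^ n * a ≠ 0) : IsUnit a := by
  have : NeZero (p ^ (n + 1)) := ⟨pow_ne_zero _ hp.ne_zero⟩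
  obtain ⟨k, rfl⟩ := ZMod.natCast_zmod_surjective a
  rw [ZMod.isUnit_iff_coprime]
  apply Nat.Coprime.pow_right
  rw [Nat.coprime_comm, hp.coprime_iff_not_dvd]
  rintro ⟨l, rfl⟩
  apply h
  rw [Nat.cast_mul, ← mul_assoc, ← pow_succ, ← Nat.cast_pow, ZMod.natCast_self, zero_mul]

lemma ZMod.exists_eq_mul_of_pow_mul_eq_zero {p n : ℕ} (hp : p.Prime) {a : ZMod (p ^ (n + 1))}
    (h : (p : ZMod (p ^ (n + 1))) ^ n * a = 0) : ∃ b, a = p * b := by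
  have : NeZero (p ^ (n + 1)) := ⟨pow_ne_zero _ hp.ne_zero⟩
  obtain ⟨k, rfl⟩ := ZMod.natCast_zmod_surjective a
  rw [← Nat.cast_pow, ← Nat.cast_mul, ZMod.natCast_eq_zero_iff, pow_succ,
    Nat.mul_dvd_mul_iff_left (pow_pos hp.pos n)] at h
  obtain ⟨l, rfl⟩ := h
  exact ⟨l, by push_cast; rfl⟩

/-- Makes the biadditive commutator form bilinear over `ℤ/q` at no cost. -/
lemma AddMonoidHom.map_smul_of_natCast_surjective {R M N : Type*} [Ring R] [AddCommGroup M]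
    [AddCommGroup N] [Module R M] [Module R N] (hR : ∀ r : R, ∃ k : ℕ, (k : R) = r)
    (f : M →+ N) (r : R) (x : M) : f (r • x) = r • f x := by
  obtain ⟨k, rfl⟩ := hR r
  rw [Nat.cast_smul_eq_nsmul, Nat.cast_smul_eq_nsmul, map_nsmul]

lemma ULift.natCast_zmod_surjective {q : ℕ} [NeZero q] (r : ULift.{u} (ZMod q)) :
    ∃ k : ℕ, (k : ULift.{u} (ZMod q)) = r := by
  obtain ⟨k, hk⟩ := ZMod.natCast_zmod_surjective r.down
  exact ⟨k, ULift.ext _ _ hk⟩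

/-- A group of class two with cyclic commutator subgroup and homocyclic central quotient is
isoclinic to a Heisenberg group. -/
theorem exists_isoclinic_heis {G : Type u} [Group G] {p n r : ℕ} (hp : p.Prime)
    (h : commutator G ≤ Subgroup.center G)
    (γ : commutator G ≃* Multiplicative (ULift.{u} (ZMod (p ^ (n + 1)))))
    (ψ : G ⧸ Subgroup.center G ≃* (Fin r → commutator G)) :
    ∃ m : ℕ, 0 < m ∧ Isoclinic G (Heis (Fin m) (ULift.{u} (ZMod (p ^ (n + 1))))) := by
  have : NeZero (p ^ (n + 1)) := ⟨pow_ne_zero _ hp.ne_zero⟩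
  have hnt : Fact (1 < p ^ (n + 1)) := ⟨Nat.one_lt_pow (Nat.succ_ne_zero n) hp.one_lt⟩
  let R := ULift.{u} (ZMod (p ^ (n + 1)))
  have hR : ∀ x : R, ∃ k : ℕ, (k : R) = x := ULift.natCast_zmod_surjective
  let e : G ⧸ Subgroup.center G ≃* Multiplicative (Fin r → R) :=
    ψ.trans { Equiv.arrowCongr (Equiv.refl _) γ.toEquiv with
      map_mul' := fun a b => funext fun i => map_mul γ (a i) (b i) }
  let b : (Fin r → R) → (Fin r → R) → R := fun v w =>
    (γ (commutatorMap G (e.symm (Multiplicative.ofAdd v)) (e.symm (Multiplicative.ofAdd w)))).toAdd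
  have hadd : ∀ v v' w, b (v + v') w = b v w + b v' w := fun v v' w => by
    simp only [b, ofAdd_add, map_mul, commutatorMap_mul_left h, toAdd_mul]
  have hadd' : ∀ v w w', b v (w + w') = b v w + b v w' := fun v w w' => by
    simp only [b, ofAdd_add, map_mul, commutatorMap_mul_right h, toAdd_mul]
  let B : LinearMap.BilinForm R (Fin r → R) := LinearMap.mk₂ R b hadd
    (fun c v w => AddMonoidHom.map_smul_of_natCast_surjective hR
      (AddMonoidHom.mk' (fun v => b v w) fun _ _ => hadd _ _ _) c v)
    hadd'
    (fun c v w => AddMonoidHom.map_smul_of_natCast_surjective hR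
      (AddMonoidHom.mk' (b v) fun _ _ => hadd' _ _ _) c w)
  have hBe : ∀ x y : G ⧸ Subgroup.center G,
      B (e x).toAdd (e y).toAdd = (γ (commutatorMap G x y)).toAdd := fun x y => by
    change b _ _ = _
    simp [b]
  have halt : B.IsAlt := fun v => by
    change b v v = 0
    simp [b, commutatorMap_self]
  have hnd : ∀ v, (∀ w, B v w = 0) → v = 0 := by
    intro v hv
    obtain ⟨x, hx⟩ := e.surjective (Multiplicative.ofAdd v)
    have hx' : v = (e x).toAdd := by rw [hx]; rfl
    have : x = 1 := eq_one_of_commutatorMap_eq_one fun y => by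
      have := hv (e y).toAdd
      rw [hx', hBe] at this
      exact (MulEquiv.map_eq_one_iff γ).mp this
    rw [hx', this, map_one, toAdd_one]
  obtain ⟨m, f, hf⟩ := LinearMap.BilinForm.exists_symplectic_equiv halt hnd (p : R) n
    (by
      rw [← Nat.cast_pow]
      exact ULift.ext _ _ (ZMod.natCast_self _))
    (by
      intro a ha
      have : IsUnit (ULift.ringEquiv a) := ZMod.isUnit_of_pow_mul_ne_zero hp fun h0 =>
        ha (ULift.ext _ _ h0)
      simpa using this)
    (by
      intro v hv
      have : ∀ i, ∃ c : R, v i = p * c := fun i => by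
        obtain ⟨c, hc⟩ := ZMod.exists_eq_mul_of_pow_mul_eq_zero hp
          (congrArg ULift.down (congrFun hv i))
        exact ⟨⟨c⟩, ULift.ext _ _ hc⟩
      choose w hw using this
      exact ⟨w, funext hw⟩)
  -- With `m = 0` the central quotient, hence `γ₂(G)`, would be trivial, whereas `γ₂(G)` is a copy
  -- of the nontrivial ring.
  have hm : 0 < m := by
    by_contra! hm0
    obtain rfl : m = 0 := by omega
    have hsub : Subsingleton (G ⧸ Subgroup.center G) :=
      (e.toEquiv.trans (Multiplicative.toAdd.trans f.toEquiv)).subsingleton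
    have hC : Subsingleton (commutator G) := by
      rw [commutator_eq_bot_of_subsingleton hsub]
      infer_instance
    exact not_subsingleton R γ.symm.toEquiv.subsingleton
  have : Nonempty (Fin m) := ⟨⟨0, hm⟩⟩
  let F : G ⧸ Subgroup.center G ≃* Multiplicative ((Fin m → R) × (Fin m → R)) :=
    e.trans (AddEquiv.toMultiplicative f.toAddEquiv)
  refine ⟨m, hm, Isoclinic.of_models Heis.form
    (F.toMonoidHom.comp (QuotientGroup.mk' _))
    (F.surjective.comp (QuotientGroup.mk'_surjective _)) ?_ γ ?_
    Heis.toProd Heis.toProd_surjective Heis.ker_toProd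
    Heis.commutatorEquiv Heis.commutatorEquiv_commutatorMap⟩
  · ext x
    simp
  · intro x y
    exact congrArg Multiplicative.ofAdd ((hBe x y).symm.trans (hf _ _))

/-! ### Passage to the central product and conclusion -/

lemma Isoclinic.trans_mulEquiv {G H : Type*} {K : Type*} [Group G] [Group H] [Group K]
    (h : Isoclinic G H) (e : H ≃* K) : Isoclinic G K := by
  obtain ⟨φ, θ, hφθ⟩ := h
  have hc : (Subgroup.center H).map e.toMonoidHom = Subgroup.center K := by
    ext x
    constructor
    · rintro ⟨y, hy, rfl⟩
      exact (Subgroup.mem_center_iff.mpr fun z => by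
        have := Subgroup.mem_center_iff.mp hy (e.symm z)
        simpa using congrArg e this)
    · intro hx
      refine ⟨e.symm x, Subgroup.mem_center_iff.mpr fun z => e.injective ?_, by simp⟩
      simpa using Subgroup.mem_center_iff.mp hx (e z)
  have hk : (commutator H).map e.toMonoidHom = commutator K := by
    rw [commutator_def, Subgroup.map_commutator, Subgroup.map_top_of_surjective _ e.surjective,
      ← commutator_def]
  refine ⟨φ.trans (QuotientGroup.congr _ _ e hc),
    θ.trans ((e.subgroupMap (commutator H)).trans (MulEquiv.subgroupCongr hk)), fun a b => ?_⟩
  simp only [MulEquiv.trans_apply, hφθ]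
  obtain ⟨x, hx⟩ := QuotientGroup.mk_surjective (φ a)
  obtain ⟨y, hy⟩ := QuotientGroup.mk_surjective (φ b)
  rw [← hx, ← hy]
  exact Subtype.ext (map_commutatorElement e x y)

theorem theorem11p2 {G : Type u} [Group G] [Finite G] (p : ℕ) (hp : p.Prime)
    (hG : IsPGroup p G) (hclass : Group.nilpotencyClass G = 2)
    (d : ℕ) (hd : d = Group.rank G ∨ d = Group.rank (G ⧸ Subgroup.center G))
    (heq : Nat.card (G ⧸ Subgroup.center G) = Nat.card (commutator G) ^ d) :
    ∃ (m q : ℕ) (X : Type u) (_ : CommGroup X)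
      (H : Fin m → Type u) (_ : ∀ i, Group (H i)) (_ : ∀ i, Finite (H i))
      (θ : ∀ i, X ≃* Subgroup.center (H i)),
      0 < m ∧ IsCyclic X ∧ Nat.card X = q ∧
      (∀ i, IsPGroup p (H i) ∧ Group.rank (H i) = 2 ∧
        commutator (H i) = Subgroup.center (H i) ∧
        IsCyclic (commutator (H i)) ∧ Nat.card (commutator (H i)) = q) ∧
      Isoclinic G (AmalgamatedCentralProduct (fun i => (θ i).toMonoidHom)) := by
  have hle := commutator_le_center_of_nilpotencyClass_eq_two hclass
  have hbot := commutator_ne_bot_of_nilpotencyClass_eq_two hclass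
  have hrank : Group.rank (G ⧸ Subgroup.center G) ≤ d := by
    rcases hd with rfl | rfl
    · exact Group.rank_le_of_surjective (QuotientGroup.mk' _) (QuotientGroup.mk'_surjective _)
    · exact le_rfl
  obtain ⟨hcyc, r, ⟨ψ⟩⟩ := isCyclic_commutator_and_nonempty_mulEquiv hle hbot hrank heq
  have : Fact p.Prime := ⟨hp⟩
  obtain ⟨k, hk⟩ := IsPGroup.iff_card.mp (hG.to_subgroup (commutator G))
  obtain ⟨n, rfl⟩ : ∃ n, k = n + 1 := by
    refine Nat.exists_eq_succ_of_ne_zero ?_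
    rintro rfl
    exact hbot (Subgroup.card_eq_one.mp (by simpa using hk))
  have : NeZero (p ^ (n + 1)) := ⟨pow_ne_zero _ hp.ne_zero⟩
  have : Fact (1 < p ^ (n + 1)) := ⟨Nat.one_lt_pow (Nat.succ_ne_zero n) hp.one_lt⟩
  -- The lift places `X` and the factors in the universe of `G`.
  let R := ULift.{u} (ZMod (p ^ (n + 1)))
  let γ : commutator G ≃* Multiplicative R :=
    (zmodCyclicMulEquiv hcyc).symm.trans (AddEquiv.toMultiplicative
      ((ZMod.ringEquivCongr hk).toAddEquiv.trans AddEquiv.ulift.symm))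
  have hcardR : Nat.card R = p ^ (n + 1) := by simp [R]
  have : Finite R := Nat.finite_of_card_ne_zero (by rw [hcardR]; exact NeZero.ne _)
  obtain ⟨m, hm, hiso⟩ := exists_isoclinic_heis hp hle γ ψ
  have : Nonempty (Fin m) := ⟨⟨0, hm⟩⟩
  refine ⟨m, p ^ (n + 1), Multiplicative R, inferInstance, fun _ => Heis Unit R,
    fun _ => inferInstance, fun _ => inferInstance, fun _ => Heis.centerEquiv, hm,
    isCyclic_of_surjective γ γ.surjective, hcardR, fun _ => ⟨Heis.isPGroup hcardR,
      Heis.rank_eq_two ULift.natCast_zmod_surjective, Heis.commutator_eq_center,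
      isCyclic_of_surjective (γ.trans Heis.commutatorEquiv.symm) (MulEquiv.surjective _),
      (Nat.card_congr Heis.commutatorEquiv.toEquiv).trans hcardR⟩,
    hiso.trans_mulEquiv Heis.amalgamEquiv.symm⟩
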